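/- **Conventions.** $\mathbb{R}^d$ carries its Euclidean norm and matrices the operator norm. To a sequence $A_1,\dots,A_p$ in $GL(d,\mathbb{R})$ one associates the linear cocycle $\mathcal{A}$ on the bundle $\{1,\dots,p\}\times\mathbb{R}^d$ that maps the $i$-th fibre to the $(i+1)$-th one by $A_i$ for $i<p$, and the $p$-th fibre to the first one by $A_p$. It is *bounded by* $C$ if $C^{-1}<\|\mathcal{A}(v)\|<C$ for every unit vector $v$ of the bundle. It is a *saddle cocycle* if no eigenvalue of the product $A_p\cdots A_1$ has modulus $1$, some eigenvalue has modulus greater than $1$, and some eigenvalue has modulus less than $1$. Its stable bundle $E^s$ (resp. unstable bundle $E^u$) consists of the vectors whose forward (resp. backward) iterates under $\mathcal{A}$ tend to $0$. The stable/unstable splitting $E^s\oplus E^u$ is *$N$-dominated* if $\|\mathcal{A}^N(u)\|<\tfrac12\|\mathcal{A}^N(v)\|$ for all unit vectors $u\in E^s_i$, $v\in E^u_i$ in a same fibre $i$. Its *minimum angle* is the minimum, over all fibres $i$, of the angles between a nonzero vector of $E^s_i$ and a nonzero vector of $E^u_i$. **Proposition.** Let $\epsilon,C>0$ and $d\in\mathbb{N}$.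 There exists an integer $N\in\mathbb{N}$ such that, for any sequence $A_1,\dots,A_p$ of length $p\ge N$ of matrices in $GL(d,\mathbb{R})$ that satisfies the following: - the corresponding linear cocycle $\mathcal{A}$ is bounded by $C$, - it is a saddle cocycle whose stable/unstable splitting is not $N$-dominated, - the eigenvalues of the product $A_p\cdots A_1$ are all real, there are, for $1\le k\le p$, continuous paths $\{A_{k,t}\}_{t\in[0,1]}$ in $GL(d,\mathbb{R})$ such that - $(A_{1,0},\dots,A_{p,0})=(A_1,\dots,A_p)$; - for all $t\in[0,1]$, the eigenvalues of the product $A_{p,t}\cdots A_{1,t}$, counted with multiplicity, are equal to those of $A_{p,0}\cdots A_{1,0}$; - the stable/unstable splitting of the cocycle given by $A_{1,1},\dots,A_{p,1}$ has a minimum angle less than $\epsilon$; - the radii of the paths are less than $\epsilon$, that is, $$\max_{1\le k\le p,\ t\in[0,1]}\left\{\|A_{k,t}-A_{k,0}\|,\ \|A_{k,t}^{-1}-A_{k,0}^{-1}\|\right\}<\epsilon.$$ -/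

import Mathlib

open Filter Topology

namespace SaddleCocycle

/-- Euclidean space `ℝ^d`. -/
abbrev E (d : ℕ) : Type := EuclideanSpace ℝ (Fin d)

/-- The linear map of `ℝ^d` (with its Euclidean norm) given by a real matrix. -/
noncomputable abbrev act {d : ℕ} (M : Matrix (Fin d) (Fin d) ℝ) : E d →L[ℝ] E d :=
  Matrix.toEuclideanCLM (𝕜 := ℝ) M

/-- The operator norm of a matrix, for the Euclidean norm of `ℝ^d`. -/
noncomputable def opNorm {d : ℕ} (M : Matrix (Fin d) (Fin d) ℝ) : ℝ := ‖act M‖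

theorem act_act_inv {d : ℕ} (g : GL (Fin d) ℝ) (v : E d) :
    act (g : Matrix (Fin d) (Fin d) ℝ) (act ((g⁻¹ : GL (Fin d) ℝ) : Matrix (Fin d) (Fin d) ℝ) v)
      = v := by
  rw [← mul_apply_eq_comp, ← map_mul, Units.mul_inv, map_one,
    one_apply_eq_self]

theorem act_inv_act {d : ℕ} (g : GL (Fin d) ℝ) (v : E d) :
    act ((g⁻¹ : GL (Fin d) ℝ) : Matrix (Fin d) (Fin d) ℝ) (act (g : Matrix (Fin d) (Fin d) ℝ) v)
      = v := by
  rw [← mul_apply_eq_comp, ← map_mul, Units.inv_mul, map_one,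
    one_apply_eq_self]

variable {p d : ℕ}

/-- The linear cocycle associated with `A_1, …, A_p`: the bijection of the bundle
`{1, …, p} × ℝ^d` that sends the `i`-th fibre to the `(i+1)`-th one (the last one to the first)
by the matrix `A_i`. The map `finRotate p` is the cyclic successor. -/
noncomputable def cocycle (A : Fin p → GL (Fin d) ℝ) : Equiv.Perm (Fin p × E d) where
  toFun x := (finRotate p x.1, act (A x.1 : Matrix (Fin d) (Fin d) ℝ) x.2)
  invFun y := ((finRotate p).symm y.1,
    act ((A ((finRotate p).symm y.1))⁻¹ : GL (Fin d) ℝ).1 y.2)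
  left_inv x := by
    simp only [Equiv.symm_apply_apply]
    exact Prod.ext rfl (act_inv_act (A x.1) x.2)
  right_inv y := by
    simp only [Equiv.apply_symm_apply]
    exact Prod.ext rfl (act_act_inv (A ((finRotate p).symm y.1)) y.2)

/-- The vector part of the `n`-th iterate, `n : ℤ`, of the cocycle at the vector `v` of the
`i`-th fibre. -/
noncomputable def iter (A : Fin p → GL (Fin d) ℝ) (n : ℤ) (i : Fin p) (v : E d) : E d :=
  ((cocycle A ^ n) (i, v)).2

theorem cocycle_zpow_linear (A : Fin p → GL (Fin d) ℝ) (n : ℤ) :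
    ∃ (σ : Fin p → Fin p) (L : Fin p → E d →ₗ[ℝ] E d),
      ∀ i v, (cocycle A ^ n) (i, v) = (σ i, L i v) := by
  induction n using Int.induction_on with
  | zero => exact ⟨id, fun _ => LinearMap.id, fun i v => by simp⟩
  | succ n ih =>
    obtain ⟨σ, L, h⟩ := ih
    refine ⟨fun i => finRotate p (σ i),
      fun i => (act (A (σ i) : Matrix (Fin d) (Fin d) ℝ)).toLinearMap ∘ₗ L i, fun i v => ?_⟩
    rw [add_comm, zpow_one_add, Equiv.Perm.mul_apply, h]
    rfl
  | pred n ih =>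
    obtain ⟨σ, L, h⟩ := ih
    refine ⟨fun i => (finRotate p).symm (σ i),
      fun i => (act ((A ((finRotate p).symm (σ i)))⁻¹ : GL (Fin d) ℝ).1).toLinearMap ∘ₗ L i,
      fun i v => ?_⟩
    rw [sub_eq_neg_add, zpow_add, zpow_neg_one, Equiv.Perm.mul_apply, h]
    rfl

theorem iter_add (A : Fin p → GL (Fin d) ℝ) (n : ℤ) (i : Fin p) (u v : E d) :
    iter A n i (u + v) = iter A n i u + iter A n i v := by
  obtain ⟨σ, L, h⟩ := cocycle_zpow_linear A n
  simp [iter, h]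

theorem iter_smul (A : Fin p → GL (Fin d) ℝ) (n : ℤ) (i : Fin p) (c : ℝ) (v : E d) :
    iter A n i (c • v) = c • iter A n i v := by
  obtain ⟨σ, L, h⟩ := cocycle_zpow_linear A n
  simp [iter, h]

theorem iter_zero (A : Fin p → GL (Fin d) ℝ) (n : ℤ) (i : Fin p) :
    iter A n i 0 = 0 := by
  simpa using iter_smul A n i 0 0

/-- The fibre over `i` of the stable bundle `E^s`: the vectors whose forward iterates under the
cocycle tend to zero. -/
noncomputable def stable (A : Fin p → GL (Fin d) ℝ) (i : Fin p) : Submodule ℝ (E d) where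
  carrier := {v | Tendsto (fun n : ℕ => iter A (n : ℤ) i v) atTop (𝓝 0)}
  zero_mem' := by simp [iter_zero]
  add_mem' {u v} hu hv := by simpa [iter_add] using Tendsto.add hu hv
  smul_mem' c v hv := by simpa [iter_smul] using Tendsto.const_smul hv c

/-- The fibre over `i` of the unstable bundle `E^u`: the vectors whose backward iterates under
the cocycle tend to zero. -/
noncomputable def unstable (A : Fin p → GL (Fin d) ℝ) (i : Fin p) : Submodule ℝ (E d) where
  carrier := {v | Tendsto (fun n : ℕ => iter A (-(n : ℤ)) i v) atTop (𝓝 0)}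
  zero_mem' := by simp [iter_zero]
  add_mem' {u v} hu hv := by simpa [iter_add] using Tendsto.add hu hv
  smul_mem' c v hv := by simpa [iter_smul] using Tendsto.const_smul hv c

/-- The cocycle is bounded by `C`: `C⁻¹ < ‖𝒜 v‖ < C` for each unit vector `v` of the bundle. -/
def IsBoundedBy (A : Fin p → GL (Fin d) ℝ) (C : ℝ) : Prop :=
  ∀ (i : Fin p) (v : E d), ‖v‖ = 1 →
    C⁻¹ < ‖(cocycle A (i, v)).2‖ ∧ ‖(cocycle A (i, v)).2‖ < C

/-- The product `A_p × ⋯ × A_1`. -/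
noncomputable def cocycleProd (A : Fin p → GL (Fin d) ℝ) : GL (Fin d) ℝ :=
  (List.ofFn A).reverse.prod

/-- The complex eigenvalues, counted with (algebraic) multiplicity, of the product
`A_p × ⋯ × A_1`. -/
noncomputable def eigenvalues (A : Fin p → GL (Fin d) ℝ) : Multiset ℂ :=
  (cocycleProd A : Matrix (Fin d) (Fin d) ℝ).charpoly.aroots ℂ

/-- Saddle cocycles: no eigenvalue of the product has modulus `1`, some have modulus greater
than `1` and some have modulus less than `1`. -/
def IsSaddle (A : Fin p → GL (Fin d) ℝ) : Prop :=
  (∀ μ ∈ eigenvalues A, ‖μ‖ ≠ 1) ∧ (∃ μ ∈ eigenvalues A, 1 < ‖μ‖) ∧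
    (∃ μ ∈ eigenvalues A, ‖μ‖ < 1)

/-- `N`-domination of a splitting into the (invariant) subbundles `F` and `G`. -/
def IsDominated (A : Fin p → GL (Fin d) ℝ) (F G : Fin p → Submodule ℝ (E d)) (N : ℕ) : Prop :=
  ∀ (i : Fin p), ∀ u ∈ F i, ∀ v ∈ G i, ‖u‖ = 1 → ‖v‖ = 1 →
    ‖iter A (N : ℤ) i u‖ < 1 / 2 * ‖iter A (N : ℤ) i v‖

/-- The set of all the angles between a nonzero stable vector and a nonzero unstable vector of
a same fibre. -/
def stableUnstableAngles (A : Fin p → GL (Fin d) ℝ) : Set ℝ :=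
  {θ | ∃ (i : Fin p), ∃ u ∈ stable A i, ∃ v ∈ unstable A i, u ≠ 0 ∧ v ≠ 0 ∧
    θ = InnerProductGeometry.angle u v}

end SaddleCocycle

namespace SaddleCocycle

/-! ### Iterates of the cocycle as matrix products -/

variable {p d : ℕ}

/-! If some stable/unstable angle is already less than `ε`, the constant path works. Otherwise the
two bundles are uniformly transverse, and the cocycle is deformed by changes of coordinates in the
fibres. Such conjugations preserve the spectrum of the product and carry stable and unstable vectors
along, so only two things remain: the conjugating maps must vary slowly along the orbit, and at some
fibre they must push an unstable vector close to the stable bundle.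

Failure of `N`-domination gives unit vectors `u` stable and `v` unstable in one fibre, with `u`
contracted over `N` steps not much more than `v`. Choose a functional `ψ` that kills the stable
space, with `ψ v = 1` and norm controlled by the transversality. The endomorphism `y ↦ ψ y • u` has
square zero; conjugating it by the cocycle for `n` steps gives norms `f n`. This sequence is
bounded, starts below a constant, and satisfies `f N ≥ 1/2`. Hence for `N` large it cannot halve
within every window of length `m`: there is a time `n` with `f j < 2 * f n` whenever `|j - n| ≤ m`
(`exists_flat_max`).

Around this time, conjugate by `1 + t * (tent function) * (B / f n) * (transported endomorphism)`.
The transported endomorphisms are intertwined by the cocycle, so only the increments of the tent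
function, at most `1 / m`, are felt: the perturbation has size `O(B / m)` (`exists_conj_path`). At
the centre, the end of the path is a shear of strength `B`, which sends a suitable unstable `w` to
`w + B • e` with `e` a stable unit vector (`exists_angle_lt_conj`).

The real spectrum serves to show, by elementary linear dynamics, that the two bundles span each
fibre (`stable_sup_unstable_eq_top`). -/

theorem act_mul_apply (M N : Matrix (Fin d) (Fin d) ℝ) (v : E d) :
    act (M * N) v = act M (act N v) := by
  rw [act, map_mul]
  rfl

/-- The fibre reached from the `i`-th one after `n` steps. -/
def fiber (i : Fin p) (n : ℕ) : Fin p := (finRotate p ^ n) i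

/-- The matrix of the `n`-th forward iterate of the cocycle on the `i`-th fibre. -/
noncomputable def partialProd (A : Fin p → GL (Fin d) ℝ) (i : Fin p) : ℕ → GL (Fin d) ℝ
  | 0 => 1
  | n + 1 => A (fiber i n) * partialProd A i n

@[simp] theorem fiber_zero (i : Fin p) : fiber i 0 = i := rfl

theorem fiber_succ (i : Fin p) (n : ℕ) : fiber i (n + 1) = finRotate p (fiber i n) := by
  simp [fiber, pow_succ']

theorem fiber_fiber (i : Fin p) (m n : ℕ) : fiber (fiber i m) n = fiber i (m + n) := by
  rw [add_comm]
  simp [fiber, pow_add]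

theorem fiber_zero_val (hp : 0 < p) (n : ℕ) (hn : n < p) :
    fiber (⟨0, hp⟩ : Fin p) n = ⟨n, hn⟩ := by
  induction n with
  | zero => rfl
  | succ n ih =>
    obtain ⟨q, rfl⟩ : ∃ q, p = q + 1 := ⟨p - 1, by omega⟩
    rw [fiber_succ, ih (by omega), finRotate_of_lt (by simpa using hn)]

theorem fiber_zero_period (hp : 0 < p) : fiber (⟨0, hp⟩ : Fin p) p = ⟨0, hp⟩ := by
  obtain ⟨q, rfl⟩ : ∃ q, p = q + 1 := ⟨p - 1, by omega⟩
  rw [fiber_succ, fiber_zero_val _ _ (Nat.lt_succ_self q)]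
  exact finRotate_last'

theorem exists_fiber_eq (i j : Fin p) : ∃ n < p, fiber i n = j := by
  have hp : 0 < p := i.pos
  rcases le_or_gt i j with h | h
  · refine ⟨j - i, by omega, ?_⟩
    have h1 : fiber ⟨0, hp⟩ (i : ℕ) = i := fiber_zero_val hp i i.2
    have h2 := fiber_fiber ⟨0, hp⟩ (i : ℕ) (j - i)
    rw [h1, fiber_zero_val hp (i + (j - i)) (by omega)] at h2
    rw [h2]
    ext
    simp only
    omega
  · refine ⟨p - i + j, by omega, ?_⟩
    have h1 : fiber ⟨0, hp⟩ (i : ℕ) = i := fiber_zero_val hp i i.2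
    have h2 : fiber (fiber ⟨0, hp⟩ (i : ℕ)) (p - i + j) = fiber (fiber ⟨0, hp⟩ p) j := by
      rw [fiber_fiber, fiber_fiber]
      congr 1
      omega
    rw [h1, fiber_zero_period, fiber_zero_val hp j j.2] at h2
    exact h2

theorem cocycle_pow_apply (A : Fin p → GL (Fin d) ℝ) (n : ℕ) (i : Fin p) (v : E d) :
    (cocycle A ^ n) (i, v) = (fiber i n, act (partialProd A i n).1 v) := by
  induction n with
  | zero => simp [partialProd]
  | succ n ih =>
    rw [pow_succ', Equiv.Perm.mul_apply, ih, fiber_succ, partialProd, Units.val_mul, act_mul_apply]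
    rfl

theorem iter_natCast (A : Fin p → GL (Fin d) ℝ) (n : ℕ) (i : Fin p) (v : E d) :
    iter A n i v = act (partialProd A i n).1 v := by
  rw [iter, zpow_natCast, cocycle_pow_apply]

theorem cocycle_zpow_neg_fiber (A : Fin p → GL (Fin d) ℝ) (n : ℕ) (i : Fin p) (v : E d) :
    (cocycle A ^ (-(n : ℤ))) (fiber i n, v) = (i, act ((partialProd A i n)⁻¹).1 v) := by
  rw [zpow_neg, Equiv.Perm.inv_eq_iff_eq, zpow_natCast, cocycle_pow_apply, act_act_inv]

theorem iter_neg_fiber (A : Fin p → GL (Fin d) ℝ) (n : ℕ) (i : Fin p) (v : E d) :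
    iter A (-(n : ℤ)) (fiber i n) v = act ((partialProd A i n)⁻¹).1 v := by
  rw [iter, cocycle_zpow_neg_fiber]

theorem exists_fiber_eq' (j : Fin p) (n : ℕ) : ∃ i, fiber i n = j :=
  ⟨(finRotate p ^ n).symm j, by simp [fiber]⟩

theorem iter_fiber_add (A : Fin p → GL (Fin d) ℝ) (z : ℤ) (n : ℕ) (i : Fin p) (v : E d) :
    iter A z (fiber i n) (act (partialProd A i n).1 v) = iter A (z + n) i v := by
  rw [iter, iter, zpow_add, Equiv.Perm.mul_apply, zpow_natCast, cocycle_pow_apply]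

theorem act_partialProd_mem_stable {A : Fin p → GL (Fin d) ℝ} {i : Fin p} {v : E d}
    (hv : v ∈ stable A i) (n : ℕ) : act (partialProd A i n).1 v ∈ stable A (fiber i n) := by
  change Tendsto (fun k : ℕ => iter A k (fiber i n) (act (partialProd A i n).1 v)) atTop (𝓝 0)
  simp only [iter_fiber_add]
  simpa using (tendsto_add_atTop_iff_nat n).2
    (show Tendsto (fun k : ℕ => iter A k i v) atTop (𝓝 0) from hv)

theorem act_partialProd_mem_unstable {A : Fin p → GL (Fin d) ℝ} {i : Fin p} {v : E d}
    (hv : v ∈ unstable A i) (n : ℕ) : act (partialProd A i n).1 v ∈ unstable A (fiber i n) := by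
  change Tendsto (fun k : ℕ => iter A (-(k : ℤ)) (fiber i n) (act (partialProd A i n).1 v))
    atTop (𝓝 0)
  simp only [iter_fiber_add]
  rw [← tendsto_add_atTop_iff_nat n]
  simpa using (show Tendsto (fun k : ℕ => iter A (-(k : ℤ)) i v) atTop (𝓝 0) from hv)

theorem sup_eq_top_of_sup_eq_top {A : Fin p → GL (Fin d) ℝ} {i : Fin p}
    (h : stable A i ⊔ unstable A i = ⊤) (j : Fin p) : stable A j ⊔ unstable A j = ⊤ := by
  obtain ⟨n, -, rfl⟩ := exists_fiber_eq i j
  refine eq_top_iff.2 fun y _ => ?_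
  have hy : act ((partialProd A i n)⁻¹).1 y ∈ stable A i ⊔ unstable A i := h ▸ Submodule.mem_top
  obtain ⟨s, hs, w, hw, hsw⟩ := Submodule.mem_sup.1 hy
  refine Submodule.mem_sup.2 ⟨_, act_partialProd_mem_stable hs n, _,
    act_partialProd_mem_unstable hw n, ?_⟩
  rw [← map_add, hsw, act_act_inv]

theorem reverse_prod_take_ofFn (A : Fin p → GL (Fin d) ℝ) (hp : 0 < p) (n : ℕ) (hn : n ≤ p) :
    ((List.ofFn A).take n).reverse.prod = partialProd A ⟨0, hp⟩ n := by
  induction n with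
  | zero => simp [partialProd]
  | succ n ih =>
    rw [List.take_add_one, partialProd, ← ih (by omega), fiber_zero_val hp n (by omega)]
    simp [show n < p by omega]

theorem cocycleProd_eq (A : Fin p → GL (Fin d) ℝ) (hp : 0 < p) :
    cocycleProd A = partialProd A ⟨0, hp⟩ p := by
  rw [← reverse_prod_take_ofFn A hp p le_rfl, cocycleProd, List.take_of_length_le (by simp)]

/-! ### Conjugate cocycles: spectrum and invariant bundles -/

/-- The cocycle obtained by a change of coordinates `g i` in each fibre. -/
noncomputable def conj (g A : Fin p → GL (Fin d) ℝ) (i : Fin p) : GL (Fin d) ℝ :=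
  g (finRotate p i) * A i * (g i)⁻¹

theorem partialProd_conj (g A : Fin p → GL (Fin d) ℝ) (i : Fin p) (n : ℕ) :
    partialProd (conj g A) i n = g (fiber i n) * partialProd A i n * (g i)⁻¹ := by
  induction n with
  | zero => simp [partialProd]
  | succ n ih => simp [partialProd, ih, conj, fiber_succ, mul_assoc]

theorem eigenvalues_conj (g A : Fin p → GL (Fin d) ℝ) :
    eigenvalues (conj g A) = eigenvalues A := by
  rcases Nat.eq_zero_or_pos p with rfl | hp
  · rw [Subsingleton.elim (conj g A) A]
  · have h : (cocycleProd (conj g A) : Matrix (Fin d) (Fin d) ℝ).charpoly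
        = (cocycleProd A : Matrix (Fin d) (Fin d) ℝ).charpoly := by
      rw [cocycleProd_eq _ hp, cocycleProd_eq _ hp, partialProd_conj, fiber_zero_period]
      generalize partialProd A ⟨0, hp⟩ p = M
      rw [Units.val_mul, Units.val_mul, Matrix.coe_units_inv]
      exact Matrix.charpoly_units_conj (g ⟨0, hp⟩) (M : Matrix (Fin d) (Fin d) ℝ)
    rw [eigenvalues, eigenvalues, h]

/-- Finitely many linear maps have a common norm bound, so applying them in any order preserves
convergence to zero. -/
theorem tendsto_act_of_tendsto {ι : Type*} [Finite ι] (g : ι → GL (Fin d) ℝ) {σ : ℕ → ι}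
    {x : ℕ → E d} (hx : Tendsto x atTop (𝓝 0)) :
    Tendsto (fun n => act (g (σ n)).1 (x n)) atTop (𝓝 0) := by
  obtain ⟨K, hK⟩ := (Set.finite_range fun i => ‖act (g i).1‖).bddAbove
  refine squeeze_zero_norm (a := fun n => K * ‖x n‖) (fun n => ?_) (by simpa using hx.norm.const_mul K)
  exact ((act (g (σ n)).1).le_opNorm _).trans
    (mul_le_mul_of_nonneg_right (hK ⟨σ n, rfl⟩) (norm_nonneg _))

theorem act_mem_stable_conj {g A : Fin p → GL (Fin d) ℝ} {i : Fin p} {v : E d}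
    (hv : v ∈ stable A i) : act (g i).1 v ∈ stable (conj g A) i := by
  change Tendsto (fun n : ℕ => iter (conj g A) n i (act (g i).1 v)) atTop (𝓝 0)
  have : Tendsto (fun n : ℕ => iter A n i v) atTop (𝓝 0) := hv
  refine (tendsto_act_of_tendsto g (σ := fiber i) this).congr fun n => ?_
  rw [iter_natCast, iter_natCast, partialProd_conj, Units.val_mul, Units.val_mul, act_mul_apply,
    act_mul_apply, act_inv_act]

theorem act_mem_unstable_conj {g A : Fin p → GL (Fin d) ℝ} {i : Fin p} {v : E d}
    (hv : v ∈ unstable A i) : act (g i).1 v ∈ unstable (conj g A) i := by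
  change Tendsto (fun n : ℕ => iter (conj g A) (-(n : ℤ)) i (act (g i).1 v)) atTop (𝓝 0)
  have : Tendsto (fun n : ℕ => iter A (-(n : ℤ)) i v) atTop (𝓝 0) := hv
  choose σ hσ using fun n => exists_fiber_eq' i n
  refine (tendsto_act_of_tendsto g (σ := σ) this).congr fun n => ?_
  have h1 := iter_neg_fiber A n (σ n) v
  have h2 := iter_neg_fiber (conj g A) n (σ n) (act (g i).1 v)
  rw [hσ] at h1 h2
  rw [h1, h2, partialProd_conj, hσ]
  simp only [mul_inv_rev, inv_inv, Units.val_mul, act_mul_apply, act_inv_act]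

/-! ### Norm bounds on the matrices and their inverses -/

theorem norm_act_le {A : Fin p → GL (Fin d) ℝ} {C : ℝ} (hA : IsBoundedBy A C) (i : Fin p)
    (v : E d) : ‖act (A i).1 v‖ ≤ C * ‖v‖ := by
  rcases eq_or_ne v 0 with rfl | hv
  · simp
  have h := (hA i (‖v‖⁻¹ • v) (by rw [norm_smul, norm_inv, norm_norm, inv_mul_cancel₀ (by simpa)])).2
  change ‖act (A i).1 (‖v‖⁻¹ • v)‖ < C at h
  rw [map_smul, norm_smul, norm_inv, norm_norm, inv_mul_lt_iff₀ (by simpa)] at h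
  linarith

theorem norm_act_inv_le {A : Fin p → GL (Fin d) ℝ} {C : ℝ} (hC : 0 < C) (hA : IsBoundedBy A C)
    (i : Fin p) (v : E d) : ‖act ((A i)⁻¹).1 v‖ ≤ C * ‖v‖ := by
  set w := act ((A i)⁻¹).1 v with hw
  have hv : v = act (A i).1 w := by rw [hw, act_act_inv]
  rcases eq_or_ne w 0 with h0 | h0
  · rw [h0]; simp; positivity
  have h := (hA i (‖w‖⁻¹ • w) (by rw [norm_smul, norm_inv, norm_norm, inv_mul_cancel₀ (by simpa)])).1
  change C⁻¹ < ‖act (A i).1 (‖w‖⁻¹ • w)‖ at h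
  rw [map_smul, norm_smul, norm_inv, norm_norm, ← hv, inv_lt_iff_one_lt_mul₀ hC, mul_assoc, lt_inv_mul_iff₀ (by simpa)] at h
  linarith

/-! ### Spanning by stable and unstable vectors when the spectrum is real -/

theorem tendsto_zero_of_le_mul_add {a : ℝ} (ha0 : 0 ≤ a) (ha : a < 1) {b c : ℕ → ℝ}
    (hb : ∀ n, 0 ≤ b n) (hc : Tendsto c atTop (𝓝 0)) (h : ∀ n, b (n + 1) ≤ a * b n + c n) :
    Tendsto b atTop (𝓝 0) := by
  rw [Metric.tendsto_atTop]
  intro ε hε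
  have hε' : 0 < ε / 2 * (1 - a) := by
    have : 0 < 1 - a := by linarith
    positivity
  obtain ⟨N, hN⟩ := eventually_atTop.1 (hc.eventually (gt_mem_nhds hε'))
  have key : ∀ k, b (N + k) ≤ ε / 2 + a ^ k * b N := by
    intro k
    induction k with
    | zero => simp; linarith
    | succ k ih =>
      have h1 := h (N + k)
      have h2 := hN (N + k) (by omega)
      have h3 := mul_le_mul_of_nonneg_left ih ha0
      rw [← add_assoc, pow_succ]
      linarith
  have hlim : Tendsto (fun k : ℕ => a ^ k * b N) atTop (𝓝 0) := by
    simpa using (tendsto_pow_atTop_nhds_zero_of_lt_one ha0 ha).mul_const (b N)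
  obtain ⟨K, hK⟩ := eventually_atTop.1 (hlim.eventually (gt_mem_nhds (half_pos hε)))
  refine ⟨N + K, fun n hn => ?_⟩
  obtain ⟨k, rfl⟩ : ∃ k, n = N + k := ⟨n - N, by omega⟩
  have h1 := key k
  have h2 := hK k (by omega)
  rw [Real.dist_eq, sub_zero, abs_of_nonneg (hb _)]
  linarith

theorem tendsto_zero_of_eq_smul_add {V : Type*} [NormedAddCommGroup V] [NormedSpace ℝ V] {a : ℝ}
    (ha : |a| < 1) {x y : ℕ → V} (hy : Tendsto y atTop (𝓝 0))
    (h : ∀ n, x (n + 1) = a • x n + y n) : Tendsto x atTop (𝓝 0) := by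
  rw [tendsto_zero_iff_norm_tendsto_zero] at hy ⊢
  refine tendsto_zero_of_le_mul_add (abs_nonneg a) ha (fun n => norm_nonneg _) hy fun n => ?_
  rw [h n, ← Real.norm_eq_abs, ← norm_smul]
  exact norm_add_le _ _

section LinearDynamics

open Polynomial

variable {V : Type*} [NormedAddCommGroup V] [NormedSpace ℝ V] {T T' : Module.End ℝ V}

/-- The orbit satisfies the affine recursion `T ^ (n + 1) v = a • T ^ n v + T ^ n (T v - a • v)`, a
contraction with vanishing forcing term. -/
theorem tendsto_pow_of_abs_lt_one {a : ℝ} (ha : |a| < 1) {v : V}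
    (h : Tendsto (fun n : ℕ => (T ^ n) (T v - a • v)) atTop (𝓝 0)) :
    Tendsto (fun n : ℕ => (T ^ n) v) atTop (𝓝 0) := by
  refine tendsto_zero_of_eq_smul_add ha h fun n => ?_
  rw [map_sub, map_smul, pow_succ, Module.End.mul_apply]
  abel

theorem tendsto_pow_of_one_lt_abs (hT : T' * T = 1) {a : ℝ} (ha : 1 < |a|) {v : V}
    (h : Tendsto (fun n : ℕ => (T' ^ n) (T v - a • v)) atTop (𝓝 0)) :
    Tendsto (fun n : ℕ => (T' ^ n) v) atTop (𝓝 0) := by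
  have ha0 : a ≠ 0 := by
    rintro rfl
    simp at ha
    linarith
  have ha' : |a⁻¹| < 1 := by
    rw [abs_inv]
    exact inv_lt_one_of_one_lt₀ ha
  have h1 := ((tendsto_add_atTop_iff_nat 1).2 h).const_smul (-a⁻¹)
  rw [smul_zero] at h1
  refine tendsto_zero_of_eq_smul_add ha' h1 fun n => ?_
  have h2 : T' (T v) = v := by rw [← Module.End.mul_apply, hT, Module.End.one_apply]
  rw [map_sub, map_smul, pow_succ, Module.End.mul_apply, Module.End.mul_apply, h2, smul_sub,
    smul_smul, neg_mul, inv_mul_cancel₀ ha0]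
  simp

/-- Linear factors are peeled off one at a time, so repeated roots need no Jordan form. -/
theorem tendsto_pow_of_aeval_prod {S : Module.End ℝ V} {s : Multiset ℝ}
    (hstep : ∀ a ∈ s, ∀ v : V, Tendsto (fun n : ℕ => (S ^ n) (T v - a • v)) atTop (𝓝 0) →
      Tendsto (fun n : ℕ => (S ^ n) v) atTop (𝓝 0)) {v : V}
    (h : Tendsto (fun n : ℕ => (S ^ n) (aeval T (s.map fun a => X - C a).prod v)) atTop (𝓝 0)) :
    Tendsto (fun n : ℕ => (S ^ n) v) atTop (𝓝 0) := by
  induction s using Multiset.induction_on with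
  | empty => simpa using h
  | cons a s ih =>
    refine ih (fun b hb => hstep b (Multiset.mem_cons_of_mem hb)) ?_
    refine hstep a (Multiset.mem_cons_self a s) _ ?_
    simpa [Algebra.algebraMap_eq_smul_one] using h

theorem isCoprime_prod_map {ι R : Type*} [CommRing R] {f g : ι → R} {s t : Multiset ι}
    (h : ∀ a ∈ s, ∀ b ∈ t, IsCoprime (f a) (g b)) :
    IsCoprime (s.map f).prod (t.map g).prod := by
  induction s using Multiset.induction_on with
  | empty => simpa using isCoprime_one_left
  | cons a s ihs =>
    rw [Multiset.map_cons, Multiset.prod_cons]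
    refine IsCoprime.mul_left ?_ (ihs fun x hx => h x (Multiset.mem_cons_of_mem hx))
    have ha := h a (Multiset.mem_cons_self a s)
    clear ihs h
    induction t using Multiset.induction_on with
    | empty => simpa using isCoprime_one_right
    | cons b t iht =>
      rw [Multiset.map_cons, Multiset.prod_cons]
      exact IsCoprime.mul_right (ha b (Multiset.mem_cons_self b t))
        (iht fun x hx => ha x (Multiset.mem_cons_of_mem hx))

/-- The factors with roots inside the unit disc are coprime to those with roots outside, so the
space is the sum of the two kernels. Forward orbits decay on the first kernel, backward orbits on
the second. -/
theorem exists_add_tendsto_pow (hT : T' * T = 1) {s : Multiset ℝ} (hs : ∀ a ∈ s, |a| ≠ 1)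
    (h : aeval T (s.map fun a => X - C a).prod = 0) (y : V) :
    ∃ u w, u + w = y ∧ Tendsto (fun n : ℕ => (T ^ n) u) atTop (𝓝 0) ∧
      Tendsto (fun n : ℕ => (T' ^ n) w) atTop (𝓝 0) := by
  classical
  set P := ((s.filter fun a => |a| < 1).map fun a => X - C a).prod with hP
  set Q := ((s.filter fun a => ¬ |a| < 1).map fun a => X - C a).prod with hQ
  have hPQ : P * Q = (s.map fun a => X - C a).prod := by
    rw [hP, hQ, ← Multiset.prod_add, ← Multiset.map_add, Multiset.filter_add_not]
  have hcop : IsCoprime P Q := by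
    rw [hP, hQ]
    refine isCoprime_prod_map fun a ha b hb => ?_
    rw [Multiset.mem_filter] at ha hb
    refine isCoprime_X_sub_C_of_isUnit_sub (sub_ne_zero.2 ?_).isUnit
    rintro rfl
    exact hb.2 ha.2
  have hker := sup_ker_aeval_eq_ker_aeval_mul_of_coprime T hcop
  rw [hPQ, h, LinearMap.ker_zero] at hker
  obtain ⟨u, hu, w, hw, rfl⟩ := Submodule.mem_sup.1 (hker ▸ Submodule.mem_top : y ∈ _)
  rw [LinearMap.mem_ker] at hu hw
  refine ⟨u, w, rfl, ?_, ?_⟩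
  · refine tendsto_pow_of_aeval_prod (T := T) (s := s.filter fun a => |a| < 1)
      (fun a ha v hv => ?_) (by simp [← hP, hu])
    exact tendsto_pow_of_abs_lt_one (Multiset.mem_filter.1 ha).2 hv
  · refine tendsto_pow_of_aeval_prod (T := T) (s := s.filter fun a => ¬ |a| < 1)
      (fun a ha v hv => ?_) (by rw [← hQ, hw]; simp)
    obtain ⟨h1, h2⟩ := Multiset.mem_filter.1 ha
    exact tendsto_pow_of_one_lt_abs hT (lt_of_le_of_ne (not_lt.1 h2) (hs a h1).symm) hv

end LinearDynamics

theorem charpoly_splits_of_im_eq_zero {M : Matrix (Fin d) (Fin d) ℝ}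
    (h : ∀ μ ∈ M.charpoly.aroots ℂ, μ.im = 0) : M.charpoly.Splits := by
  refine Polynomial.Splits.of_splits_map_of_injective (i := algebraMap ℝ ℂ)
    (algebraMap ℝ ℂ).injective (IsAlgClosed.splits _) fun μ hμ => ?_
  exact ⟨μ.re, Complex.ext rfl (h μ hμ).symm⟩

/-- The endomorphism of `ℝ^d` given by a matrix. -/
noncomputable def actEnd : Matrix (Fin d) (Fin d) ℝ ≃ₐ[ℝ] Module.End ℝ (E d) :=
  Matrix.toLpLinAlgEquiv 2

theorem actEnd_apply (M : Matrix (Fin d) (Fin d) ℝ) (v : E d) : actEnd M v = act M v := rfl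

theorem actEnd_inv_mul (g : GL (Fin d) ℝ) : actEnd (g⁻¹).1 * actEnd g.1 = 1 := by
  rw [← map_mul, Units.inv_mul, map_one]

theorem actEnd_pow_mul_inv_pow (g : GL (Fin d) ℝ) (n : ℕ) :
    actEnd g.1 ^ n * actEnd (g⁻¹).1 ^ n = 1 := by
  rw [← map_pow, ← map_pow, ← map_mul, ← Units.val_pow_eq_pow_val, ← Units.val_pow_eq_pow_val,
    inv_pow, Units.mul_inv, map_one]

theorem cocycle_pow_period (A : Fin p → GL (Fin d) ℝ) (hp : 0 < p) (n : ℕ) (v : E d) :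
    ((cocycle A ^ p) ^ n) (⟨0, hp⟩, v)
      = (⟨0, hp⟩, (actEnd (cocycleProd A).1 ^ n) v) := by
  induction n with
  | zero => simp
  | succ n ih =>
    rw [pow_succ', Equiv.Perm.mul_apply, ih, cocycle_pow_apply, fiber_zero_period,
      ← cocycleProd_eq, pow_succ', Module.End.mul_apply, actEnd_apply]

theorem cocycle_pow_period_inv (A : Fin p → GL (Fin d) ℝ) (hp : 0 < p) (n : ℕ) (v : E d) :
    ((cocycle A ^ p) ^ n)⁻¹ (⟨0, hp⟩, v)
      = (⟨0, hp⟩, (actEnd ((cocycleProd A)⁻¹).1 ^ n) v) := by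
  rw [Equiv.Perm.inv_eq_iff_eq, cocycle_pow_period, ← Module.End.mul_apply,
    actEnd_pow_mul_inv_pow, Module.End.one_apply]

/-- Convergence along multiples of the period suffices: by Euclidean division, any iterate differs
from such a one by one of finitely many partial products. -/
theorem mem_stable_of_tendsto_pow {A : Fin p → GL (Fin d) ℝ} (hp : 0 < p) {v : E d}
    (h : Tendsto (fun n : ℕ => (actEnd (cocycleProd A).1 ^ n) v)
      atTop (𝓝 0)) : v ∈ stable A ⟨0, hp⟩ := by
  change Tendsto (fun n : ℕ => iter A n ⟨0, hp⟩ v) atTop (𝓝 0)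
  refine (tendsto_act_of_tendsto (fun r : Fin p => partialProd A ⟨0, hp⟩ r)
    (σ := fun n => ⟨n % p, Nat.mod_lt n hp⟩)
    (h.comp (Nat.tendsto_div_const_atTop hp.ne'))).congr fun n => ?_
  have h1 : cocycle A ^ n = cocycle A ^ (n % p) * (cocycle A ^ p) ^ (n / p) := by
    rw [← pow_mul, ← pow_add, Nat.mod_add_div]
  rw [iter, zpow_natCast, h1, Equiv.Perm.mul_apply, cocycle_pow_period, cocycle_pow_apply]
  rfl

theorem mem_unstable_of_tendsto_pow {A : Fin p → GL (Fin d) ℝ} (hp : 0 < p) {v : E d}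
    (h : Tendsto (fun n : ℕ => (actEnd ((cocycleProd A)⁻¹).1 ^ n) v)
      atTop (𝓝 0)) : v ∈ unstable A ⟨0, hp⟩ := by
  change Tendsto (fun n : ℕ => iter A (-(n : ℤ)) ⟨0, hp⟩ v) atTop (𝓝 0)
  -- A backward iterate from the base fibre inverts a forward product that ends there, so a starting
  -- fibre is chosen for each length.
  choose b hb using fun n => exists_fiber_eq' (⟨0, hp⟩ : Fin p) n
  refine (tendsto_act_of_tendsto (fun r : Fin p => (partialProd A (b r) r)⁻¹)
    (σ := fun n => ⟨n % p, Nat.mod_lt n hp⟩)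
    (h.comp (Nat.tendsto_div_const_atTop hp.ne'))).congr fun n => ?_
  have h1 : cocycle A ^ (-(n : ℤ))
      = cocycle A ^ (-((n % p : ℕ) : ℤ)) * ((cocycle A ^ p) ^ (n / p))⁻¹ := by
    rw [← pow_mul, ← zpow_natCast, ← zpow_neg, ← zpow_add]
    congr 1
    have := Nat.mod_add_div n p
    zify at this ⊢
    linarith
  rw [iter, h1, Equiv.Perm.mul_apply, cocycle_pow_period_inv]
  have h2 := iter_neg_fiber A (n % p) (b (n % p))
  rw [hb] at h2
  exact (h2 _).symm

theorem stable_sup_unstable_eq_top {A : Fin p → GL (Fin d) ℝ}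
    (h1 : ∀ μ ∈ eigenvalues A, ‖μ‖ ≠ 1) (hreal : ∀ μ ∈ eigenvalues A, μ.im = 0) (i : Fin p) :
    stable A i ⊔ unstable A i = ⊤ := by
  have hp : 0 < p := i.pos
  refine sup_eq_top_of_sup_eq_top (i := ⟨0, hp⟩) (eq_top_iff.2 fun y _ => ?_) i
  set M : Matrix (Fin d) (Fin d) ℝ := (cocycleProd A).1 with hM
  have hsplit := charpoly_splits_of_im_eq_zero (M := M) hreal
  have hroots : ∀ a ∈ M.charpoly.roots, |a| ≠ 1 := by
    intro a ha
    have := h1 (a : ℂ) ?_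
    · simpa using this
    · rw [eigenvalues, Polynomial.mem_aroots]
      rw [Polynomial.mem_roots'] at ha
      refine ⟨ha.1, ?_⟩
      have h2 := ha.2
      rw [Polynomial.IsRoot.def] at h2
      have h3 := Polynomial.aeval_algebraMap_apply_eq_algebraMap_eval (A := ℂ) a M.charpoly
      rw [h2, map_zero] at h3
      exact h3
  have haeval : Polynomial.aeval (actEnd M)
      (M.charpoly.roots.map fun a => Polynomial.X - Polynomial.C a).prod = 0 := by
    rw [← hsplit.eq_prod_roots_of_monic M.charpoly_monic]
    rw [Polynomial.aeval_algHom_apply, Matrix.aeval_self_charpoly, map_zero]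
  obtain ⟨u, w, huw, hu, hw⟩ := exists_add_tendsto_pow
    (T := (actEnd M)) (T' := actEnd ((cocycleProd A)⁻¹).1)
    (actEnd_inv_mul _) hroots haeval y
  exact Submodule.mem_sup.2 ⟨u, mem_stable_of_tendsto_pow hp hu, w,
    mem_unstable_of_tendsto_pow hp hw, huw⟩

/-! ### Sequences without flat local maxima -/

/-- The index `j` may lie to the right of `n`, so induction on `n` is unavailable. Instead each pass
halves the excess over `D` in the a priori bound `M`, which therefore leaves no trace in the
conclusion. -/
theorem le_of_forall_exists_le_half {f : ℕ → ℝ} {M D : ℝ} {m : ℕ} (hM : ∀ n, f n ≤ M)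
    (hM0 : 0 ≤ M) (h : ∀ n, m ≤ n → ∃ j, n ≤ j + m ∧ f n ≤ f j / 2) (hD0 : 0 ≤ D)
    (hD : ∀ j < m, f j ≤ D) (n : ℕ) : f n ≤ D := by
  have key : ∀ k n, f n ≤ D + M * (1 / 2) ^ k := by
    intro k
    induction k with
    | zero => intro n; simpa using (hM n).trans (by linarith)
    | succ k ih =>
      intro n
      have hpos : 0 ≤ M * (1 / 2) ^ k := by positivity
      rw [pow_succ]
      rcases lt_or_ge n m with hn | hn
      · linarith [hD n hn]
      · obtain ⟨j, -, hj⟩ := h n hn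
        linarith [ih j]
  have hlim : Tendsto (fun k : ℕ => D + M * (1 / 2 : ℝ) ^ k) atTop (𝓝 (D + M * 0)) :=
    ((tendsto_pow_atTop_nhds_zero_of_lt_one (by norm_num) (by norm_num)).const_mul M).const_add D
  rw [mul_zero, add_zero] at hlim
  exact ge_of_tendsto' hlim fun k => key k n

/-- A bounded sequence without approximate local maxima decays exponentially. -/
theorem le_div_two_pow_of_forall_exists_le_half {f : ℕ → ℝ} {M D : ℝ} {m : ℕ}
    (hM : ∀ n, f n ≤ M) (hM0 : 0 ≤ M) (h : ∀ n, m ≤ n → ∃ j, n ≤ j + m ∧ f n ≤ f j / 2)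
    (hD0 : 0 ≤ D) (hD : ∀ j < m, f j ≤ D) (q : ℕ) : ∀ n, q * m ≤ n → f n ≤ D / 2 ^ q := by
  induction q with
  | zero => intro n _; simpa using le_of_forall_exists_le_half hM hM0 h hD0 hD n
  | succ q ih =>
    intro n hn
    rw [Nat.succ_mul] at hn
    -- Moving left by at most `m` from `n ≥ (q + 1) * m` keeps `j ≥ q * m`, where the inductive
    -- bound applies.
    obtain ⟨j, hj, hj'⟩ := h n (by omega)
    have := ih j (by omega)
    rw [pow_succ, ← div_div]
    linarith

/-! ### Angles, transversality and dual functionals -/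

section Angles

open InnerProductGeometry

variable {V : Type*} [NormedAddCommGroup V] [InnerProductSpace ℝ V]

theorem inner_le_cos_mul_of_le_angle {x y : V} {ε : ℝ} (h0 : 0 ≤ ε) (h : ε ≤ angle x y) :
    inner ℝ x y ≤ Real.cos ε * (‖x‖ * ‖y‖) := by
  rw [← cos_angle_mul_norm_mul_norm]
  exact mul_le_mul_of_nonneg_right (Real.cos_le_cos_of_nonneg_of_le_pi h0 (angle_le_pi x y) h)
    (by positivity)

/-- Completing the square: `‖w + s‖ ^ 2` is at least `(‖s‖ - cos ε * ‖w‖) ^ 2 + (sin ε * ‖w‖) ^ 2`.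
-/
theorem sin_mul_norm_le_norm_add {s w : V} {ε : ℝ} (h0 : 0 ≤ ε)
    (h : ε ≤ angle (-s) w) : Real.sin ε * ‖w‖ ≤ ‖w + s‖ := by
  have h2 := inner_le_cos_mul_of_le_angle h0 h
  rw [inner_neg_left, norm_neg, real_inner_comm] at h2
  refine abs_le_of_sq_le_sq' ?_ (norm_nonneg _) |>.2
  rw [norm_add_sq_real]
  nlinarith [sq_nonneg (‖s‖ - Real.cos ε * ‖w‖), Real.sin_sq_add_cos_sq ε]

/-- The cosine of the angle is at least `(B - K) / (B + K)`, and `hB` says that this exceeds `cos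
ε`. -/
theorem angle_add_smul_lt {e w : V} {ε K B : ℝ} (he : ‖e‖ = 1) (hε0 : 0 ≤ ε) (hε1 : ε ≤ Real.pi / 2)
    (hw : ‖w‖ ≤ K) (hB : K * (1 + Real.cos ε) < B * (1 - Real.cos ε)) :
    w + B • e ≠ 0 ∧ angle e (w + B • e) < ε := by
  have hc0 : 0 ≤ Real.cos ε := Real.cos_nonneg_of_neg_pi_div_two_le_of_le (by linarith) hε1
  have hc1 : Real.cos ε ≤ 1 := Real.cos_le_one ε
  have hK : 0 ≤ K := (norm_nonneg _).trans hw
  have hB0 : 0 < B := by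
    by_contra hB0
    nlinarith
  have hin : B - K ≤ inner ℝ e (w + B • e) := by
    rw [inner_add_right, real_inner_smul_right, real_inner_self_eq_norm_sq, he]
    have := neg_le_of_abs_le (abs_real_inner_le_norm e w)
    rw [he] at this
    linarith
  have hnorm : ‖w + B • e‖ ≤ B + K := by
    refine (norm_add_le _ _).trans ?_
    rw [norm_smul, he, Real.norm_eq_abs, abs_of_pos hB0]
    linarith
  have hlt : Real.cos ε * (B + K) < B - K := by linarith
  refine ⟨fun h => ?_, ?_⟩
  · rw [h, inner_zero_right] at hin
    nlinarith
  · by_contra! h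
    have h1 := inner_le_cos_mul_of_le_angle hε0 h
    rw [he, one_mul] at h1
    nlinarith

/-- Take the inner product with the component `z` of `v` orthogonal to `S`, divided by `‖z‖ ^ 2`;
its norm is `1 / ‖z‖`, and `‖z‖` is at least `σ`. -/
theorem exists_dual_vector_of_le_norm_add [CompleteSpace V] (S : Submodule ℝ V)
    [S.HasOrthogonalProjection] {v : V} {σ : ℝ} (hσ : 0 < σ) (h : ∀ s ∈ S, σ ≤ ‖v + s‖) :
    ∃ ψ : V →L[ℝ] ℝ, ψ v = 1 ∧ (∀ s ∈ S, ψ s = 0) ∧ ‖ψ‖ ≤ σ⁻¹ := by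
  set z := v - S.starProjection v with hz
  have hzS : ∀ s ∈ S, inner ℝ z s = 0 := fun s hs => by
    rw [real_inner_comm]
    exact S.sub_starProjection_mem_orthogonal v s hs
  have hσz : σ ≤ ‖z‖ := by
    rw [hz, sub_eq_add_neg]
    exact h _ (S.neg_mem (S.starProjection_apply_mem v))
  have hz0 : 0 < ‖z‖ := hσ.trans_le hσz
  have hzv : inner ℝ z v = ‖z‖ ^ 2 := by
    have h1 : v = z + S.starProjection v := by rw [hz]; abel
    rw [← real_inner_self_eq_norm_sq]
    conv_lhs => rw [h1, inner_add_right, hzS _ (S.starProjection_apply_mem v), add_zero]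
  refine ⟨(‖z‖ ^ 2)⁻¹ • innerSL ℝ z, ?_, fun s hs => ?_, ?_⟩
  · simp [hzv, hz0.ne']
  · simp [hzS s hs]
  · rw [norm_smul, innerSL_apply_norm, norm_inv, norm_pow, norm_norm, pow_two, mul_inv, mul_assoc,
      inv_mul_cancel₀ hz0.ne', mul_one]
    exact inv_anti₀ hσ hσz

theorem exists_norm_le_one_apply_eq_norm [CompleteSpace V] (ψ : V →L[ℝ] ℝ) :
    ∃ y : V, ‖y‖ ≤ 1 ∧ ψ y = ‖ψ‖ := by
  set z := (InnerProductSpace.toDual ℝ V).symm ψ with hz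
  have hn : ‖z‖ = ‖ψ‖ := by rw [hz, LinearIsometryEquiv.norm_map]
  have happ : ∀ x, ψ x = inner ℝ z x := fun x => by rw [hz, InnerProductSpace.toDual_symm_apply]
  rcases eq_or_ne z 0 with h0 | h0
  · exact ⟨0, by simp, by rw [← hn, h0]; simp⟩
  · have h1 : ‖z‖ ≠ 0 := by simpa
    refine ⟨‖z‖⁻¹ • z, by rw [norm_smul, norm_inv, norm_norm, inv_mul_cancel₀ h1], ?_⟩
    rw [happ, real_inner_smul_right, real_inner_self_eq_norm_sq, pow_two, ← mul_assoc,
      inv_mul_cancel₀ h1, one_mul, hn]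

end Angles

/-- Angles do not see positive scaling, so the set is a finite union of continuous images of
products of compact unit spheres. -/
theorem exists_isLeast_stableUnstableAngles {A : Fin p → GL (Fin d) ℝ}
    (h : (stableUnstableAngles A).Nonempty) : ∃ θ, IsLeast (stableUnstableAngles A) θ := by
  have heq : stableUnstableAngles A = ⋃ i, (fun x : E d × E d => InnerProductGeometry.angle x.1 x.2) ''
      (((stable A i : Set (E d)) ∩ Metric.sphere 0 1) ×ˢ
        ((unstable A i : Set (E d)) ∩ Metric.sphere 0 1)) := by
    ext θ
    simp only [stableUnstableAngles, Set.mem_ofPred_eq, Set.mem_iUnion, Set.mem_image, Prod.exists,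
      Set.mem_prod, Set.mem_inter_iff, mem_sphere_zero_iff_norm, SetLike.mem_coe]
    refine exists_congr fun i => ⟨?_, ?_⟩
    · rintro ⟨u, hu, v, hv, hu0, hv0, rfl⟩
      have hu0' : 0 < ‖u‖ := norm_pos_iff.2 hu0
      have hv0' : 0 < ‖v‖ := norm_pos_iff.2 hv0
      refine ⟨‖u‖⁻¹ • u, ‖v‖⁻¹ • v, ⟨⟨Submodule.smul_mem _ _ hu, ?_⟩,
        Submodule.smul_mem _ _ hv, ?_⟩, ?_⟩
      · rw [norm_smul, norm_inv, norm_norm, inv_mul_cancel₀ hu0'.ne']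
      · rw [norm_smul, norm_inv, norm_norm, inv_mul_cancel₀ hv0'.ne']
      · rw [InnerProductGeometry.angle_smul_left_of_pos _ _ (inv_pos.2 hu0'),
          InnerProductGeometry.angle_smul_right_of_pos _ _ (inv_pos.2 hv0')]
    · rintro ⟨u, v, ⟨⟨hu, hu1⟩, hv, hv1⟩, rfl⟩
      exact ⟨u, hu, v, hv, norm_ne_zero_iff.1 (by simp [hu1]), norm_ne_zero_iff.1 (by simp [hv1]), rfl⟩
  have hcomp : IsCompact (stableUnstableAngles A) := by
    rw [heq]
    refine isCompact_iUnion fun i => IsCompact.image_of_continuousOn ?_ fun x hx => ?_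
    · exact ((isCompact_sphere _ _).inter_left (Submodule.closed_of_finiteDimensional _)).prod
        ((isCompact_sphere _ _).inter_left (Submodule.closed_of_finiteDimensional _))
    · have h1 : ‖x.1‖ = 1 := by simpa using hx.1.2
      have h2 : ‖x.2‖ = 1 := by simpa using hx.2.2
      exact (InnerProductGeometry.continuousAt_angle (norm_ne_zero_iff.1 (by simp [h1]))
        (norm_ne_zero_iff.1 (by simp [h2]))).continuousWithinAt
  exact hcomp.exists_isLeast h

/-! ### Functionals vanishing on the stable bundle -/

theorem act_inv_partialProd_mem_stable {A : Fin p → GL (Fin d) ℝ} {i : Fin p} {n : ℕ} {v : E d}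
    (hv : v ∈ stable A (fiber i n)) : act ((partialProd A i n)⁻¹).1 v ∈ stable A i := by
  change Tendsto (fun k : ℕ => iter A k i (act ((partialProd A i n)⁻¹).1 v)) atTop (𝓝 0)
  rw [← tendsto_add_atTop_iff_nat n]
  refine (show Tendsto (fun k : ℕ => iter A k (fiber i n) v) atTop (𝓝 0) from hv).congr fun k => ?_
  rw [Nat.cast_add, ← iter_fiber_add, act_act_inv]

/-- Functionals that vanish on the stable bundle have bounded forward iterates. -/
theorem exists_norm_comp_inv_partialProd_le {A : Fin p → GL (Fin d) ℝ}
    (hsplit : ∀ i, stable A i ⊔ unstable A i = ⊤) {i : Fin p} {ψ : E d →L[ℝ] ℝ}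
    (hψ : ∀ s ∈ stable A i, ψ s = 0) :
    ∃ K, ∀ n, ‖ψ.comp (act ((partialProd A i n)⁻¹).1)‖ ≤ K := by
  -- For a fixed `y`, split in each of the finitely many fibres: the functional kills the stable
  -- part, and backward iterates of the unstable part are bounded.
  refine banach_steinhaus fun y => ?_
  have hy : ∀ k, ∃ s ∈ stable A k, ∃ w ∈ unstable A k, s + w = y := fun k =>
    Submodule.mem_sup.1 (hsplit k ▸ Submodule.mem_top)
  choose s hs w hw hsw using hy
  have hbd : ∀ k, ∃ M, ∀ n : ℕ, ‖iter A (-(n : ℤ)) k (w k)‖ ≤ M := fun k => by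
    obtain ⟨M, hM⟩ := (show Tendsto (fun n : ℕ => iter A (-(n : ℤ)) k (w k)) atTop (𝓝 0)
      from hw k).norm.bddAbove_range
    exact ⟨M, fun n => hM ⟨n, rfl⟩⟩
  choose M hM using hbd
  obtain ⟨M', hM'⟩ := (Set.finite_range M).bddAbove
  refine ⟨‖ψ‖ * M', fun n => ?_⟩
  set k := fiber i n with hk
  rw [ContinuousLinearMap.comp_apply, ← hsw k, map_add, map_add,
    hψ _ (act_inv_partialProd_mem_stable (hs k)), zero_add, ← iter_neg_fiber, ← hk]
  exact (ψ.le_opNorm _).trans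
    (mul_le_mul_of_nonneg_left ((hM k n).trans (hM' ⟨k, rfl⟩)) (norm_nonneg _))

/-! ### Transport of square-zero endomorphisms along the orbit -/

theorem fiber_period (i : Fin p) : fiber i p = i := by
  have hp := i.pos
  have h : fiber ⟨0, hp⟩ (i : ℕ) = i := fiber_zero_val hp i i.2
  rw [← h, fiber_fiber, add_comm, ← fiber_fiber, fiber_zero_period]

theorem fiber_injective (i : Fin p) : Function.Injective fun n : Fin p => fiber i n :=
  Finite.injective_iff_surjective.2 fun j => by
    obtain ⟨n, hn, h⟩ := exists_fiber_eq i j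
    exact ⟨⟨n, hn⟩, h⟩

theorem partialProd_add (A : Fin p → GL (Fin d) ℝ) (i : Fin p) (m n : ℕ) :
    partialProd A i (m + n) = partialProd A (fiber i m) n * partialProd A i m := by
  induction n with
  | zero => simp [partialProd]
  | succ n ih => rw [← add_assoc, partialProd, ih, partialProd, fiber_fiber, mul_assoc]

/-- The iterate of a fibre endomorphism under the cocycle. -/
noncomputable def transport (A : Fin p → GL (Fin d) ℝ) (i : Fin p) (N : Matrix (Fin d) (Fin d) ℝ)
    (n : ℕ) : Matrix (Fin d) (Fin d) ℝ :=
  (partialProd A i n).1 * N * ((partialProd A i n)⁻¹).1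

theorem transport_mul_self {A : Fin p → GL (Fin d) ℝ} {i : Fin p} {N : Matrix (Fin d) (Fin d) ℝ}
    (hN : N * N = 0) (n : ℕ) : transport A i N n * transport A i N n = 0 := by
  have h : ((partialProd A i n)⁻¹).1 * (partialProd A i n).1 = 1 := Units.inv_mul _
  calc transport A i N n * transport A i N n
      = (partialProd A i n).1 * N * (((partialProd A i n)⁻¹).1 * (partialProd A i n).1) * N
        * ((partialProd A i n)⁻¹).1 := by simp only [transport, mul_assoc]
    _ = (partialProd A i n).1 * (N * N) * ((partialProd A i n)⁻¹).1 := by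
      rw [h, mul_one]; simp only [mul_assoc]
    _ = 0 := by rw [hN, mul_zero, zero_mul]

theorem transport_succ_mul (A : Fin p → GL (Fin d) ℝ) (i : Fin p) (N : Matrix (Fin d) (Fin d) ℝ)
    (n : ℕ) : transport A i N (n + 1) * (A (fiber i n)).1 = (A (fiber i n)).1 * transport A i N n := by
  have h : ((A (fiber i n))⁻¹).1 * (A (fiber i n)).1 = 1 := Units.inv_mul _
  simp only [transport, partialProd, mul_inv_rev, Units.val_mul, mul_assoc, h, mul_one]

theorem transport_add (A : Fin p → GL (Fin d) ℝ) (i : Fin p) (N : Matrix (Fin d) (Fin d) ℝ)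
    (m n : ℕ) : transport A i N (m + n) = transport A (fiber i m) (transport A i N m) n := by
  simp only [transport, partialProd_add, mul_inv_rev, Units.val_mul, mul_assoc]

theorem opNorm_mul_le (M N : Matrix (Fin d) (Fin d) ℝ) : opNorm (M * N) ≤ opNorm M * opNorm N := by
  rw [opNorm, act, map_mul]
  exact norm_mul_le _ _

theorem opNorm_smul (c : ℝ) (M : Matrix (Fin d) (Fin d) ℝ) : opNorm (c • M) = |c| * opNorm M := by
  rw [opNorm, act, map_smul, norm_smul, Real.norm_eq_abs]
  rfl

theorem opNorm_neg (M : Matrix (Fin d) (Fin d) ℝ) : opNorm (-M) = opNorm M := by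
  rw [opNorm, act, map_neg, norm_neg]
  rfl

theorem opNorm_nonneg (M : Matrix (Fin d) (Fin d) ℝ) : 0 ≤ opNorm M := norm_nonneg _

/-! ### The path of conjugacies -/

/-- The unit `1 + X`, for `X` of square zero. -/
def unipotent {R : Type*} [Ring R] (X : R) (hX : X * X = 0) : Rˣ where
  val := 1 + X
  inv := 1 - X
  val_inv := by rw [add_mul, mul_sub, mul_sub, hX]; simp
  inv_val := by rw [sub_mul, mul_add, mul_add, hX]; simp

/-- The tent function of height `1` supported on `[0, 2m]`. -/
noncomputable def tent (m l : ℕ) : ℝ := max 0 (1 - |(l : ℝ) - m| / m)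

theorem tent_self (m : ℕ) : tent m m = 1 := by simp [tent]

theorem tent_zero {m : ℕ} (hm : 0 < m) : tent m 0 = 0 := by
  have : (0 : ℝ) < m := by exact_mod_cast hm
  simp [tent, this.ne']

theorem tent_of_le {m l : ℕ} (hm : 0 < m) (hl : 2 * m ≤ l) : tent m l = 0 := by
  have h1 : (0 : ℝ) < m := by exact_mod_cast hm
  have h2 : (2 * m : ℝ) ≤ l := by exact_mod_cast hl
  refine max_eq_left ?_
  rw [sub_nonpos, le_div_iff₀ h1, one_mul]
  exact le_trans (by linarith) (le_abs_self _)

theorem abs_tent_succ_sub_le {m : ℕ} (hm : 0 < m) (l : ℕ) :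
    |tent m (l + 1) - tent m l| ≤ 1 / m := by
  have h1 : (0 : ℝ) < m := by exact_mod_cast hm
  refine (abs_max_sub_max_le_max _ _ _ _).trans ?_
  rw [sub_self, abs_zero, max_eq_right (abs_nonneg _), sub_sub_sub_cancel_left, ← sub_div, abs_div,
    abs_of_pos h1]
  gcongr
  refine (abs_abs_sub_abs_le_abs_sub _ _).trans ?_
  push_cast
  rw [show (l : ℝ) - m - (l + 1 - m) = -1 by ring]
  simp

theorem continuous_conj_smul {T : Type*} [TopologicalSpace T] {c : T → ℝ} (hc : Continuous c)
    {A : GL (Fin d) ℝ} {X Y : Matrix (Fin d) (Fin d) ℝ}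
    (hX : ∀ t, (c t • X) * (c t • X) = 0) (hY : ∀ t, (c t • Y) * (c t • Y) = 0) :
    Continuous fun t => unipotent (c t • Y) (hY t) * A * (unipotent (c t • X) (hX t))⁻¹ := by
  have key : ∀ Z : Matrix (Fin d) (Fin d) ℝ, ∀ hZ : ∀ t, (c t • Z) * (c t • Z) = 0,
      Continuous fun t => unipotent (c t • Z) (hZ t) := fun Z hZ => by
    rw [Units.continuous_iff]
    exact ⟨continuous_const.add (hc.smul continuous_const),
      continuous_const.sub (hc.smul continuous_const)⟩
  exact ((key Y hY).mul continuous_const).mul (key X hX).inv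

/-- Expanding `(1 + t Y) A (1 - t X) - A` leaves `t (Y A - A X) - t² Y A X`. The quadratic term
vanishes by `h2`, and similarly for the inverse by `h3`, so the error is governed by the failure `δ`
of `X` and `Y` to be intertwined by `A`. -/
theorem opNorm_conj_sub_le {A : GL (Fin d) ℝ} {X Y N : Matrix (Fin d) (Fin d) ℝ} {C δ r t : ℝ}
    (hC : 0 ≤ C) (hA : opNorm A.1 ≤ C) (hA' : opNorm (A⁻¹).1 ≤ C) (h1 : Y * A.1 - A.1 * X = δ • (A.1 * N))
    (h2 : Y * A.1 * X = 0) (h3 : X * (A⁻¹).1 * Y = 0) (hr : |δ| * opNorm N ≤ r)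
    (ht : |t| ≤ 1) (hX : (t • X) * (t • X) = 0) (hY : (t • Y) * (t • Y) = 0) :
    opNorm ((unipotent (t • Y) hY * A * (unipotent (t • X) hX)⁻¹).1 - A.1) ≤ C * r ∧
    opNorm (((unipotent (t • Y) hY * A * (unipotent (t • X) hX)⁻¹)⁻¹).1 - (A⁻¹).1) ≤ C * r := by
  have hAA : (A⁻¹).1 * A.1 = 1 := Units.inv_mul _
  have hAA' : A.1 * (A⁻¹).1 = 1 := Units.mul_inv _
  have e1 : (unipotent (t • Y) hY * A * (unipotent (t • X) hX)⁻¹).1 - A.1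
      = (t * δ) • (A.1 * N) := by
    change (1 + t • Y) * A.1 * (1 - t • X) - A.1 = _
    have : (1 + t • Y) * A.1 * (1 - t • X) - A.1
        = t • (Y * A.1 - A.1 * X) - (t * t) • (Y * A.1 * X) := by
      simp only [add_mul, mul_sub, one_mul, mul_one, smul_mul_assoc, mul_smul_comm, smul_sub,
        smul_add, mul_smul]
      abel
    rw [this, h1, h2, smul_zero, sub_zero, smul_smul]
  have h4 : X * (A⁻¹).1 - (A⁻¹).1 * Y = -(δ • (N * (A⁻¹).1)) := by
    have h5 : (A⁻¹).1 * (Y * A.1 - A.1 * X) * (A⁻¹).1 = (A⁻¹).1 * Y - X * (A⁻¹).1 := by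
      rw [mul_sub, sub_mul]
      congr 1
      · rw [mul_assoc, mul_assoc, hAA', mul_one]
      · rw [← mul_assoc (A⁻¹).1, hAA, one_mul]
    rw [← neg_sub, ← h5, h1, mul_smul_comm, ← mul_assoc, hAA, one_mul, smul_mul_assoc]
  have e2 : ((unipotent (t • Y) hY * A * (unipotent (t • X) hX)⁻¹)⁻¹).1 - (A⁻¹).1
      = -((t * δ) • (N * (A⁻¹).1)) := by
    rw [mul_inv_rev, mul_inv_rev, inv_inv]
    change (1 + t • X) * ((A⁻¹).1 * (1 - t • Y)) - (A⁻¹).1 = _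
    have : (1 + t • X) * ((A⁻¹).1 * (1 - t • Y)) - (A⁻¹).1
        = t • (X * (A⁻¹).1 - (A⁻¹).1 * Y) - (t * t) • (X * (A⁻¹).1 * Y) := by
      simp only [add_mul, mul_sub, one_mul, mul_one, smul_mul_assoc, mul_smul_comm, smul_sub,
        smul_add, mul_smul, mul_assoc]
      abel
    rw [this, h4, h3, smul_zero, sub_zero, smul_neg, smul_smul]
  have hN := opNorm_nonneg N
  have hbd : |t * δ| * opNorm N ≤ r := by
    rw [abs_mul, mul_assoc]
    exact (mul_le_of_le_one_left (by positivity) ht).trans hr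
  constructor
  · rw [e1, opNorm_smul]
    calc |t * δ| * opNorm (A.1 * N) ≤ |t * δ| * (C * opNorm N) := by
          gcongr
          exact (opNorm_mul_le _ _).trans (by gcongr)
      _ = C * (|t * δ| * opNorm N) := by ring
      _ ≤ C * r := by gcongr
  · rw [e2, opNorm_neg, opNorm_smul]
    calc |t * δ| * opNorm (N * (A⁻¹).1) ≤ |t * δ| * (opNorm N * C) := by
          gcongr
          exact (opNorm_mul_le _ _).trans (by gcongr)
      _ = C * (|t * δ| * opNorm N) := by ring
      _ ≤ C * r := by gcongr

/-- A path of conjugate cocycles of small radius that ends with a large shear in one fibre. -/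
theorem exists_conj_path {A : Fin p → GL (Fin d) ℝ} {C : ℝ} (hC : 0 < C) (hA : IsBoundedBy A C)
    (a : Fin p) {N : Matrix (Fin d) (Fin d) ℝ} (hN : N * N = 0) {m : ℕ} (hm : 0 < m)
    (hmp : 2 * m < p) {B : ℝ} (hB : 0 ≤ B) (hpos : 0 < opNorm (transport A a N m))
    (hle : ∀ l ≤ 2 * m, opNorm (transport A a N l) ≤ 2 * opNorm (transport A a N m)) :
    ∃ g : unitInterval → Fin p → GL (Fin d) ℝ,
      (∀ k, Continuous fun t => conj (g t) A k) ∧ (∀ k, g 0 k = 1) ∧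
      (∀ k t, opNorm ((conj (g t) A k).1 - (A k).1) ≤ C * (2 * B / m) ∧
        opNorm (((conj (g t) A k)⁻¹).1 - ((A k)⁻¹).1) ≤ C * (2 * B / m)) ∧
      (g 1 (fiber a m)).1 = 1 + (B / opNorm (transport A a N m)) • transport A a N m := by
  set f := opNorm (transport A a N m) with hf
  have hm' : (0 : ℝ) < m := by exact_mod_cast hm
  choose τ hτp hτ using exists_fiber_eq a
  have hτu : ∀ l < p, τ (fiber a l) = l := fun l hl => by
    have := @fiber_injective p a ⟨τ (fiber a l), hτp _⟩ ⟨l, hl⟩ (hτ _)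
    simpa using this
  -- `τ k` is the time in `[0, p)` at which the orbit of `a` reaches fibre `k`. The generator has
  -- norm `B` at time `m` and is zero outside the window `(0, 2m)`.
  set X : Fin p → Matrix (Fin d) (Fin d) ℝ :=
    fun k => (B / f * tent m (τ k)) • transport A a N (τ k) with hX
  have hXsq : ∀ (k : Fin p) (t : ℝ), (t • X k) * (t • X k) = 0 := fun k t => by
    simp only [hX, smul_mul_assoc, mul_smul_comm, transport_mul_self hN, smul_zero]
  have hstep : ∀ k, ∃ δ : ℝ, ∃ N' : Matrix (Fin d) (Fin d) ℝ,
      X (finRotate p k) * (A k).1 - (A k).1 * X k = δ • ((A k).1 * N') ∧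
      X (finRotate p k) * (A k).1 * X k = 0 ∧ X k * ((A k)⁻¹).1 * X (finRotate p k) = 0 ∧
      |δ| * opNorm N' ≤ 2 * B / m := by
    intro k
    obtain ⟨l, hl, rfl⟩ := exists_fiber_eq a k
    rw [← fiber_succ]
    have hXl : X (fiber a l) = (B / f * tent m l) • transport A a N l := by
      simp only [hX, hτu l hl]
    -- Transport need not close up after a full period. At the seam `p - 1 → 0` this is harmless,
    -- since `2 * m < p` makes the tent vanish on both sides.
    rcases eq_or_ne (l + 1) p with hlp | hlp
    · have h0 : X (fiber a (l + 1)) = 0 := by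
        have h1 : τ (fiber a (l + 1)) = 0 := by
          rw [hlp, fiber_period]
          simpa using hτu 0 a.pos
        simp only [hX, h1, tent_zero hm, mul_zero, zero_smul]
      have h0' : X (fiber a l) = 0 := by
        rw [hXl, tent_of_le hm (by omega), mul_zero, zero_smul]
      refine ⟨0, 0, ?_, ?_, ?_, ?_⟩
      · simp [h0, h0']
      · simp [h0]
      · simp [h0]
      · rw [abs_zero, zero_mul]
        positivity
    · have hXl' : X (fiber a (l + 1)) = (B / f * tent m (l + 1)) • transport A a N (l + 1) := by
        simp only [hX, hτu (l + 1) (by omega)]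
      have hcomm := transport_succ_mul A a N l
      have hsq := transport_mul_self (A := A) (i := a) hN l
      set G := A (fiber a l)
      have hG : (G⁻¹).1 * G.1 = 1 := Units.inv_mul _
      have hG' : G.1 * (G⁻¹).1 = 1 := Units.mul_inv _
      have hcomm' : (G⁻¹).1 * transport A a N (l + 1) = transport A a N l * (G⁻¹).1 := by
        have := congrArg (fun Z => (G⁻¹).1 * Z * (G⁻¹).1) hcomm
        simpa only [mul_assoc, hG', mul_one, ← mul_assoc (G⁻¹).1 G.1, hG, one_mul] using this
      refine ⟨B / f * tent m (l + 1) - B / f * tent m l, transport A a N l, ?_, ?_, ?_, ?_⟩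
      · rw [hXl, hXl', smul_mul_assoc, hcomm, mul_smul_comm, sub_smul]
      · rw [hXl, hXl', smul_mul_assoc, hcomm, smul_mul_assoc, mul_smul_comm, mul_assoc, hsq]
        simp
      · rw [hXl, hXl', mul_smul_comm, mul_assoc, smul_mul_assoc, hcomm', ← mul_assoc, hsq]
        simp
      · rw [← mul_sub, abs_mul, abs_of_nonneg (div_nonneg hB hpos.le)]
        rcases le_or_gt (2 * m) l with h | h
        · rw [tent_of_le hm h, tent_of_le hm (by omega), sub_zero, abs_zero, mul_zero, zero_mul]
          positivity
        -- The slope `1 / m` of the tent meets flatness, `opNorm ≤ 2 * f`; the unknown size `f`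
        -- cancels.
        · calc B / f * |tent m (l + 1) - tent m l| * opNorm (transport A a N l)
              ≤ B / f * (1 / m) * (2 * f) := by
                have := hle l h.le
                have := abs_tent_succ_sub_le hm l
                have := opNorm_nonneg (transport A a N l)
                gcongr
            _ = 2 * B / m := by field_simp
  have hnorm : ∀ k, opNorm (A k).1 ≤ C := fun k =>
    ContinuousLinearMap.opNorm_le_bound _ hC.le (norm_act_le hA k)
  have hnorm' : ∀ k, opNorm ((A k)⁻¹).1 ≤ C := fun k =>
    ContinuousLinearMap.opNorm_le_bound _ hC.le (norm_act_inv_le hC hA k)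
  refine ⟨fun t k => unipotent ((t : ℝ) • X k) (hXsq k t), fun k => ?_, fun k => ?_,
    fun k t => ?_, ?_⟩
  · exact continuous_conj_smul continuous_subtype_val _ _
  · ext1
    simp [unipotent]
  · obtain ⟨δ, N', e1, e2, e3, e4⟩ := hstep k
    exact opNorm_conj_sub_le hC.le (hnorm k) (hnorm' k) e1 e2 e3 e4
      (by rw [abs_of_nonneg t.2.1]; exact t.2.2) _ _
  · simp only [unipotent, hX, hτu m (by omega), tent_self, mul_one, Set.Icc.coe_one, one_smul]

/-! ### Rank one endomorphisms and failure of domination -/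

/-- The matrix of the rank one endomorphism `y ↦ ψ y • u`. -/
noncomputable def rankOneMatrix (ψ : E d →L[ℝ] ℝ) (u : E d) : Matrix (Fin d) (Fin d) ℝ :=
  (Matrix.toEuclideanCLM (𝕜 := ℝ)).symm (ψ.smulRight u)

theorem act_rankOneMatrix (ψ : E d →L[ℝ] ℝ) (u : E d) :
    act (rankOneMatrix ψ u) = ψ.smulRight u :=
  (Matrix.toEuclideanCLM (𝕜 := ℝ)).apply_symm_apply _

theorem act_injective : Function.Injective (act : Matrix (Fin d) (Fin d) ℝ → E d →L[ℝ] E d) :=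
  (Matrix.toEuclideanCLM (𝕜 := ℝ)).injective

theorem rankOneMatrix_mul_self {ψ : E d →L[ℝ] ℝ} {u : E d} (h : ψ u = 0) :
    rankOneMatrix ψ u * rankOneMatrix ψ u = 0 := by
  refine act_injective (ContinuousLinearMap.ext fun y => ?_)
  rw [act_mul_apply, act_rankOneMatrix]
  simp [h]

theorem act_transport_rankOneMatrix (A : Fin p → GL (Fin d) ℝ) (i : Fin p) (ψ : E d →L[ℝ] ℝ)
    (u : E d) (n : ℕ) : act (transport A i (rankOneMatrix ψ u) n)
      = (ψ.comp (act ((partialProd A i n)⁻¹).1)).smulRight (act (partialProd A i n).1 u) := by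
  refine ContinuousLinearMap.ext fun y => ?_
  rw [transport, act_mul_apply, act_mul_apply, act_rankOneMatrix]
  simp

theorem opNorm_transport_rankOneMatrix (A : Fin p → GL (Fin d) ℝ) (i : Fin p) (ψ : E d →L[ℝ] ℝ)
    (u : E d) (n : ℕ) : opNorm (transport A i (rankOneMatrix ψ u) n)
      = ‖ψ.comp (act ((partialProd A i n)⁻¹).1)‖ * ‖act (partialProd A i n).1 u‖ := by
  rw [opNorm, act_transport_rankOneMatrix, ContinuousLinearMap.norm_smulRight_apply]

theorem opNorm_transport_le {A : Fin p → GL (Fin d) ℝ} {C : ℝ} (hC : 0 < C)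
    (hA : IsBoundedBy A C) (i : Fin p) (N : Matrix (Fin d) (Fin d) ℝ) (n : ℕ) :
    opNorm (transport A i N n) ≤ (C * C) ^ n * opNorm N := by
  have h1 : ∀ k, opNorm (A k).1 ≤ C := fun k =>
    ContinuousLinearMap.opNorm_le_bound _ hC.le (norm_act_le hA k)
  have h2 : ∀ k, opNorm ((A k)⁻¹).1 ≤ C := fun k =>
    ContinuousLinearMap.opNorm_le_bound _ hC.le (norm_act_inv_le hC hA k)
  induction n with
  | zero => simp [transport, partialProd]
  | succ n ih =>
    have h3 : transport A i N (n + 1)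
        = (A (fiber i n)).1 * transport A i N n * ((A (fiber i n))⁻¹).1 := by
      rw [← transport_succ_mul, mul_assoc, Units.mul_inv, mul_one]
    rw [h3]
    have hn := opNorm_nonneg (transport A i N n)
    calc _ ≤ C * opNorm (transport A i N n) * C := by
          refine (opNorm_mul_le _ _).trans (mul_le_mul ?_ (h2 _) (opNorm_nonneg _) (by positivity))
          exact (opNorm_mul_le _ _).trans (by gcongr; exact h1 _)
      _ = C * C * opNorm (transport A i N n) := by ring
      _ ≤ C * C * ((C * C) ^ n * opNorm N) := by gcongr
      _ = _ := by ring

theorem opNorm_transport_rankOneMatrix_bddAbove {A : Fin p → GL (Fin d) ℝ}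
    (hsplit : ∀ i, stable A i ⊔ unstable A i = ⊤) {i : Fin p} {ψ : E d →L[ℝ] ℝ} {u : E d}
    (hu : u ∈ stable A i) (hψ : ∀ s ∈ stable A i, ψ s = 0) :
    ∃ K, 0 ≤ K ∧ ∀ n, opNorm (transport A i (rankOneMatrix ψ u) n) ≤ K := by
  obtain ⟨K, hK⟩ := exists_norm_comp_inv_partialProd_le hsplit hψ
  obtain ⟨L, hL⟩ := (show Tendsto (fun n : ℕ => iter A n i u) atTop (𝓝 0) from hu).norm.bddAbove_range
  have hK0 : 0 ≤ K := (norm_nonneg _).trans (hK 0)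
  have hL' : ∀ n : ℕ, ‖act (partialProd A i n).1 u‖ ≤ L := fun n => by
    rw [← iter_natCast]
    exact hL ⟨n, rfl⟩
  refine ⟨K * L, mul_nonneg hK0 ((norm_nonneg _).trans (hL' 0)), fun n => ?_⟩
  rw [opNorm_transport_rankOneMatrix]
  exact mul_le_mul (hK n) (hL' n) (norm_nonneg _) hK0

/-- If the stable and unstable bundles are far from each other but not dominated, some rank one
endomorphism has a flat local maximum of norm along its orbit. -/
theorem exists_flat_max {A : Fin p → GL (Fin d) ℝ} {C σ : ℝ} (hC : 1 ≤ C)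
    (hA : IsBoundedBy A C) (hσ : 0 < σ) (hsplit : ∀ i, stable A i ⊔ unstable A i = ⊤)
    (hangle : ∀ i, ∀ s ∈ stable A i, ∀ w ∈ unstable A i, σ * ‖w‖ ≤ ‖w + s‖)
    {m q : ℕ} (hq : (C * C) ^ m * σ⁻¹ / 2 ^ q < 1 / 2)
    (hdom : ¬ IsDominated A (stable A) (unstable A) (q * m)) :
    ∃ i, ∃ u ∈ stable A i, ∃ ψ : E d →L[ℝ] ℝ, (∀ s ∈ stable A i, ψ s = 0) ∧ ∃ n, m ≤ n ∧
      ∀ j, n ≤ j + m → j ≤ n + m → opNorm (transport A i (rankOneMatrix ψ u) j)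
        < 2 * opNorm (transport A i (rankOneMatrix ψ u) n) := by
  rw [IsDominated] at hdom
  push Not at hdom
  obtain ⟨i, u, hu, v, hv, hu1, hv1, hle⟩ := hdom
  obtain ⟨ψ, hψv, hψ, hψn⟩ := exists_dual_vector_of_le_norm_add (stable A i) (v := v) hσ
    fun s hs => by simpa [hv1] using hangle i s hs v hv
  refine ⟨i, u, hu, ψ, hψ, ?_⟩
  by_contra! hcon
  set f := fun n => opNorm (transport A i (rankOneMatrix ψ u) n) with hf
  obtain ⟨K, hK0, hK⟩ := opNorm_transport_rankOneMatrix_bddAbove hsplit hu hψ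
  have hf0 : opNorm (rankOneMatrix ψ u) ≤ σ⁻¹ := by
    rw [opNorm, act_rankOneMatrix, ContinuousLinearMap.norm_smulRight_apply, hu1, mul_one]
    exact hψn
  -- `D` bounds the first `m` terms: `f 0 ≤ σ⁻¹`, and each step multiplies the norm by at most `C *
  -- C`. The bound `K` depends on the cocycle but does not enter the estimate.
  have hdecay := le_div_two_pow_of_forall_exists_le_half (f := f) (M := K)
    (D := (C * C) ^ m * σ⁻¹) (m := m) hK hK0
    (fun n hn => by
      obtain ⟨j, h1, -, h3⟩ := hcon n hn
      exact ⟨j, h1, by simp only [hf]; linarith⟩)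
    (by positivity)
    (fun j hj => by
      refine (opNorm_transport_le (by linarith) hA i _ j).trans ?_
      have : (C * C) ^ j ≤ (C * C) ^ m := pow_le_pow_right₀ (by nlinarith) hj.le
      have := opNorm_nonneg (rankOneMatrix ψ u)
      gcongr) q (q * m) le_rfl
  -- With `P` the product over `q * m` steps, `1 = ψ v = (ψ ∘ P⁻¹) (P v) ≤ ‖ψ ∘ P⁻¹‖ * ‖P v‖`, and
  -- non-domination bounds `‖P v‖` by `2 * ‖P u‖`.
  have hlow : 1 / 2 ≤ f (q * m) := by
    simp only [hf, opNorm_transport_rankOneMatrix]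
    rw [iter_natCast, iter_natCast] at hle
    have h1 := (ψ.comp (act ((partialProd A i (q * m))⁻¹).1)).le_opNorm
      (act (partialProd A i (q * m)).1 v)
    rw [ContinuousLinearMap.comp_apply, act_inv_act, hψv, norm_one] at h1
    have h2 := mul_le_mul_of_nonneg_left hle
      (norm_nonneg (ψ.comp (act ((partialProd A i (q * m))⁻¹).1)))
    linarith
  linarith

/-- The shear along a flat maximum brings the unstable bundle close to the stable one. -/
theorem exists_angle_lt_conj {A g : Fin p → GL (Fin d) ℝ} {σ B ε : ℝ} (hσ : 0 < σ)
    (hε0 : 0 ≤ ε) (hε1 : ε ≤ Real.pi / 2)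
    (hsplit : ∀ i, stable A i ⊔ unstable A i = ⊤)
    (hangle : ∀ i, ∀ s ∈ stable A i, ∀ w ∈ unstable A i, σ * ‖w‖ ≤ ‖w + s‖)
    (hB : σ⁻¹ * (1 + Real.cos ε) < B * (1 - Real.cos ε)) {k : Fin p} {u : E d} {ψ : E d →L[ℝ] ℝ}
    (hu : u ∈ stable A k) (hψ : ∀ s ∈ stable A k, ψ s = 0) (hpos : 0 < ‖ψ‖ * ‖u‖)
    (hg : ∀ y, act (g k).1 y = y + (B / (‖ψ‖ * ‖u‖)) • ψ y • u) :
    ∃ θ ∈ stableUnstableAngles (conj g A), θ < ε := by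
  have hu0 : 0 < ‖u‖ := pos_of_mul_pos_right hpos (norm_nonneg _)
  have hψ0 : 0 < ‖ψ‖ := pos_of_mul_pos_left hpos (norm_nonneg _)
  -- The unstable component `w` of a vector at which `ψ` attains its norm has `ψ w = ‖ψ‖`, while
  -- transversality keeps `‖w‖ ≤ σ⁻¹`. The shear then adds exactly `B • e` to `w` and fixes `e`.
  obtain ⟨y, hy1, hy⟩ := exists_norm_le_one_apply_eq_norm ψ
  obtain ⟨s, hs, w, hw, rfl⟩ := Submodule.mem_sup.1 (hsplit k ▸ Submodule.mem_top : y ∈ _)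
  rw [map_add, hψ s hs, zero_add] at hy
  have hwn : ‖w‖ ≤ σ⁻¹ := by
    rw [← one_div, le_div_iff₀' hσ]
    rw [add_comm] at hy1
    exact (hangle k s hs w hw).trans hy1
  set e := ‖u‖⁻¹ • u with he
  have he1 : ‖e‖ = 1 := by rw [he, norm_smul, norm_inv, norm_norm, inv_mul_cancel₀ hu0.ne']
  have heS : e ∈ stable A k := Submodule.smul_mem _ _ hu
  have hge : act (g k).1 e = e := by rw [hg, hψ e heS]; simp
  have hgw : act (g k).1 w = w + B • e := by
    rw [hg, hy, he, smul_smul, smul_smul]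
    congr 2
    field_simp
  obtain ⟨h1, h2⟩ := angle_add_smul_lt he1 hε0 hε1 hwn hB
  refine ⟨_, ⟨k, e, hge ▸ act_mem_stable_conj heS, w + B • e, hgw ▸ act_mem_unstable_conj hw, ?_,
    h1, rfl⟩, h2⟩
  exact norm_ne_zero_iff.1 (by simp [he1])

end SaddleCocycle

/-! ### Choice of constants and conclusion -/

theorem propositionp (ε C : ℝ) (hε : 0 < ε) (hC : 0 < C) (d : ℕ) :
    ∃ N : ℕ, ∀ (p : ℕ), N ≤ p → ∀ (A : Fin p → GL (Fin d) ℝ),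
      SaddleCocycle.IsBoundedBy A C →
      SaddleCocycle.IsSaddle A →
      ¬ SaddleCocycle.IsDominated A (SaddleCocycle.stable A) (SaddleCocycle.unstable A) N →
      (∀ μ ∈ SaddleCocycle.eigenvalues A, μ.im = 0) →
      ∃ γ : Fin p → unitInterval → GL (Fin d) ℝ,
        (∀ k, Continuous (γ k)) ∧
        (∀ k, γ k 0 = A k) ∧
        (∀ t, SaddleCocycle.eigenvalues (fun k => γ k t)
          = SaddleCocycle.eigenvalues (fun k => γ k 0)) ∧
        (∃ θ, IsLeast (SaddleCocycle.stableUnstableAngles (fun k => γ k 1)) θ ∧ θ < ε) ∧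
        (∀ k t,
          max
            (SaddleCocycle.opNorm ((γ k t : Matrix (Fin d) (Fin d) ℝ)
              - (γ k 0 : Matrix (Fin d) (Fin d) ℝ)))
            (SaddleCocycle.opNorm (((γ k t)⁻¹ : GL (Fin d) ℝ).1
              - ((γ k 0)⁻¹ : GL (Fin d) ℝ).1)) < ε) := by
  open SaddleCocycle in
  -- Capping at `1` keeps the angle below `π / 2`, with positive sine and cosine less than `1`.
  set ε₀ := min ε 1 with hε₀
  have hε₀0 : 0 < ε₀ := lt_min hε one_pos
  have hε₀1 : ε₀ ≤ 1 := min_le_right _ _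
  have hε₀ε : ε₀ ≤ ε := min_le_left _ _
  have hpi := Real.pi_gt_three
  set σ := Real.sin ε₀
  have hσ : 0 < σ := Real.sin_pos_of_pos_of_lt_pi hε₀0 (by linarith)
  have hcos : Real.cos ε₀ < 1 := by
    have h1 := Real.sin_sq_add_cos_sq ε₀
    have h2 : 0 < σ ^ 2 := by positivity
    nlinarith [Real.neg_one_le_cos ε₀]
  have hcos' : 0 < 1 - Real.cos ε₀ := by linarith
  -- Order of choice: the shear strength `B` from the angle, the half-window `m` from `B` and the
  -- allowed radius, then the number `q` of windows from `m`. None depends on `p` or `A`.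
  obtain ⟨B, hB⟩ := exists_gt (max 0 (σ⁻¹ * (1 + Real.cos ε₀) / (1 - Real.cos ε₀)))
  obtain ⟨hB0, hB⟩ := max_lt_iff.1 hB
  rw [div_lt_iff₀ hcos'] at hB
  obtain ⟨m, hm⟩ := exists_nat_gt (C * (2 * B) / ε)
  have hm0' : (0 : ℝ) < m := lt_of_le_of_lt (by positivity) hm
  have hm0 : 0 < m := by exact_mod_cast hm0'
  have hrad : C * (2 * B / m) < ε := by
    rw [← mul_div_assoc, div_lt_iff₀ hm0']
    rw [div_lt_iff₀ hε] at hm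
    linarith
  -- `3 ≤ q` ensures that a period `p ≥ q * m` exceeds the window length `2 * m`.
  obtain ⟨q, hq3, hq⟩ : ∃ q, 3 ≤ q ∧ (C * C) ^ m * σ⁻¹ / 2 ^ q < 1 / 2 := by
    have hlim : Tendsto (fun q : ℕ => (C * C) ^ m * σ⁻¹ / 2 ^ q) atTop (𝓝 0) :=
      tendsto_const_nhds.div_atTop (tendsto_pow_atTop_atTop_of_one_lt (by norm_num))
    exact ((eventually_ge_atTop 3).and (hlim.eventually (gt_mem_nhds (by norm_num)))).exists
  refine ⟨q * m, fun p hNp A hA hsaddle hdom hreal => ?_⟩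
  have hmp : 2 * m < p := by nlinarith
  have hsplit := stable_sup_unstable_eq_top hsaddle.1 hreal
  by_cases hsmall : ∃ θ ∈ stableUnstableAngles A, θ < ε
  · obtain ⟨θ, hθ, hθε⟩ := hsmall
    obtain ⟨θ', hθ'⟩ := exists_isLeast_stableUnstableAngles ⟨θ, hθ⟩
    refine ⟨fun k _ => A k, fun k => continuous_const, fun k => rfl, fun t => rfl,
      ⟨θ', hθ', (hθ'.2 hθ).trans_lt hθε⟩, fun k t => ?_⟩
    simpa [opNorm] using hε
  push Not at hsmall
  have hangle : ∀ i, ∀ s ∈ stable A i, ∀ w ∈ unstable A i, σ * ‖w‖ ≤ ‖w + s‖ := by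
    intro i s hs w hw
    rcases eq_or_ne w 0 with rfl | hw0
    · simp
    rcases eq_or_ne s 0 with rfl | hs0
    · rw [add_zero]
      exact mul_le_of_le_one_left (norm_nonneg _) (Real.sin_le_one _)
    exact sin_mul_norm_le_norm_add hε₀0.le (hε₀ε.trans (hsmall _
      ⟨i, -s, neg_mem hs, w, hw, neg_ne_zero.2 hs0, hw0, rfl⟩))
  -- Non-domination supplies a unit vector, hence `C⁻¹ < C`.
  have hC1 : 1 ≤ C := by
    have hdom' := hdom
    rw [IsDominated] at hdom'
    push Not at hdom'
    obtain ⟨i, u, -, -, -, hu1, -⟩ := hdom'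
    obtain ⟨h1, h2⟩ := hA i u hu1
    by_contra! h
    linarith [(one_lt_inv₀ hC).2 h]
  obtain ⟨i, u, hu, ψ, hψ, n, hmn, hflat⟩ := exists_flat_max hC1 hA hσ hsplit hangle hq hdom
  -- The window starts `m` steps before the flat maximum; `m ≤ n` makes this a genuine forward time,
  -- possibly beyond one period.
  set a := fiber i (n - m)
  set N₀ := transport A i (rankOneMatrix ψ u) (n - m)
  have htr : ∀ l, transport A a N₀ l = transport A i (rankOneMatrix ψ u) (n - m + l) := fun l =>
    (transport_add A i _ (n - m) l).symm
  have hN₀ : N₀ * N₀ = 0 := transport_mul_self (rankOneMatrix_mul_self (hψ u hu)) _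
  have hnm : n - m + m = n := by omega
  -- Strict flatness at `j = n` reads `f n < 2 * f n`, which forces positivity.
  have hposn : 0 < opNorm (transport A i (rankOneMatrix ψ u) n) := by
    have := hflat n (by omega) (by omega)
    linarith
  obtain ⟨g, hg1, hg2, hg3, hg4⟩ := exists_conj_path hC hA a hN₀ hm0 hmp hB0.le
    (by rw [htr, hnm]; exact hposn)
    (fun l hl => by
      rw [htr, htr, hnm]
      exact (hflat _ (by omega) (by omega)).le)
  rw [htr, fiber_fiber, hnm] at hg4
  have h0 : ∀ k, conj (g 0) A k = A k := fun k => by simp [conj, hg2]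
  refine ⟨fun k t => conj (g t) A k, hg1, h0, fun t => ?_, ?_, fun k t => ?_⟩
  · exact (eigenvalues_conj (g t) A).trans (eigenvalues_conj (g 0) A).symm
  · have hkill : ∀ s ∈ stable A (fiber i n), (ψ.comp (act ((partialProd A i n)⁻¹).1)) s = 0 :=
      fun s hs => hψ _ (act_inv_partialProd_mem_stable hs)
    rw [opNorm_transport_rankOneMatrix] at hposn hg4
    obtain ⟨θ, hθ, hθε⟩ := exists_angle_lt_conj (g := g 1) hσ hε₀0.le (by linarith) hsplit hangle hB
      (act_partialProd_mem_stable hu n) hkill hposn (fun y => by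
        rw [hg4, act, map_add, map_one, map_smul]
        change y + (B / _ : ℝ) • act (transport A i (rankOneMatrix ψ u) n) y = _
        rw [act_transport_rankOneMatrix]
        rfl)
    obtain ⟨θ', hθ'⟩ := exists_isLeast_stableUnstableAngles ⟨θ, hθ⟩
    exact ⟨θ', hθ', (hθ'.2 hθ).trans_lt (hθε.trans_le hε₀ε)⟩
  · simp only [h0]
    exact max_lt ((hg3 k t).1.trans_lt hrad) ((hg3 k t).2.trans_lt hrad)
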